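/- **Theorem.** Let $X$ be a (real or complex) Banach space, let $Y$ be an ordered Banach space with closed positive cone (over the same scalar field), and let $S:D(S)\subset X\to Y$ be a closed linear operator. For a linear operator $A$ in $X$ with domain $D(A)$ put $$C:=\overline{\{x\in D(S): Sx\ge 0\}},\qquad C_A:=\overline{\{x\in D(A)\cap D(S): Sx\ge 0\}}$$ (closures in $X$). If $A$ generates a $C_0$-semigroup $(e^{tA})_{t\ge 0}$, this semigroup is called *$S$-shape preserving* if (a) $C=C_A$ and (b) $e^{tA}C\subset C$ for all $t\ge 0$. Let $A$ be the generator of a $C_0$-semigroup $(e^{tA})_{t\ge0}$ on $X$, and let $V:[0,\infty)\to\mathcal L(X)$ be a strongly continuous family of bounded linear operators (that is, $t\mapsto V(t)x$ is continuous on $[0,\infty)$ for every $x\in X$) such that there are constants $M\ge 1$ and $\omega\in\mathbb R$ with $$\|V(t)^n\|\le M e^{tn\omega}\qquad\text{for all } t\ge 0,\ n\in\mathbb N.$$ Suppose that there is a core $D\subset D(A)$ of $A$ such that for every $x\in D$ $$\lim_{h\to 0+}\frac{V(h)x-x}{h}=Ax .$$ If $C=C_A$ and $V(t)C\subset C$ for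 all $t\ge 0$, then $(e^{tA})_{t\ge 0}$ is $S$-shape preserving. -/

import Mathlib

open Filter Topology
open scoped NNReal

/-- A strongly continuous one-parameter semigroup of bounded operators, indexed by `[0, ∞)`. -/
structure C0Semigroup (𝕜 X : Type*) [RCLike 𝕜] [NormedAddCommGroup X] [NormedSpace 𝕜 X] where
  /-- The operator at time `t`. -/
  op : ℝ≥0 → X →L[𝕜] X
  op_zero : op 0 = ContinuousLinearMap.id 𝕜 X
  op_add : ∀ s t : ℝ≥0, op (s + t) = (op s).comp (op t)
  strongly_continuous : ∀ x : X, Continuous fun t : ℝ≥0 => op t x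

namespace C0Semigroup

variable {𝕜 X : Type*} [RCLike 𝕜] [NormedAddCommGroup X] [NormedSpace 𝕜 X]

/-- The graph of the generator: all `(x, y)` such that `h⁻¹ (T(h) x - x) → y` as `h → 0+`. -/
def generatorGraph (T : C0Semigroup 𝕜 X) : Submodule 𝕜 (X × X) where
  carrier := {p | Tendsto (fun h : ℝ≥0 => ((h : ℝ) : 𝕜)⁻¹ • (T.op h p.1 - p.1))
    (𝓝[>] 0) (𝓝 p.2)}
  zero_mem' := by simp
  add_mem' := by
    intro p q hp hq
    refine (Tendsto.add hp hq).congr fun h => ?_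
    simp only [Prod.fst_add, map_add, ← smul_add]
    congr 1
    abel
  smul_mem' := by
    intro c p hp
    refine (Tendsto.const_smul hp c).congr fun h => ?_
    simp only [Prod.smul_fst, map_smul, ← smul_sub]
    rw [smul_comm]

/-- The generator of a strongly continuous semigroup, with its maximal domain. -/
noncomputable def generator (T : C0Semigroup 𝕜 X) : X →ₗ.[𝕜] X :=
  T.generatorGraph.toLinearPMap

/-- The generator has the graph used to define it. -/
theorem mem_graph_generator (T : C0Semigroup 𝕜 X) (x y : X) :
    (x, y) ∈ T.generator.graph ↔
      Tendsto (fun h : ℝ≥0 => ((h : ℝ) : 𝕜)⁻¹ • (T.op h x - x)) (𝓝[>] 0) (𝓝 y) := by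
  have h0 : ∀ p ∈ T.generatorGraph, p.1 = 0 → p.2 = 0 := by
    intro p hp hp1
    have hp' : Tendsto (fun h : ℝ≥0 => ((h : ℝ) : 𝕜)⁻¹ • (T.op h p.1 - p.1))
      (𝓝[>] 0) (𝓝 p.2) := hp
    simp only [hp1, map_zero, sub_zero, smul_zero] at hp'
    exact (tendsto_nhds_unique hp' tendsto_const_nhds)
  rw [generator, Submodule.toLinearPMap_graph_eq _ h0]
  rfl

end C0Semigroup

/-- The set `C = closure {x ∈ D(S) : S x ≥ 0}`. -/
def shapeCone {𝕜 X Y : Type*} [RCLike 𝕜] [NormedAddCommGroup X] [NormedSpace 𝕜 X]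
    [NormedAddCommGroup Y] [NormedSpace 𝕜 Y] [PartialOrder Y] (S : X →ₗ.[𝕜] Y) : Set X :=
  closure {x : X | ∃ hx : x ∈ S.domain, 0 ≤ S ⟨x, hx⟩}

/-- The set `C_A = closure {x ∈ D(A) ∩ D(S) : S x ≥ 0}`. -/
def shapeConeOn {𝕜 X Y : Type*} [RCLike 𝕜] [NormedAddCommGroup X] [NormedSpace 𝕜 X]
    [NormedAddCommGroup Y] [NormedSpace 𝕜 Y] [PartialOrder Y] (S : X →ₗ.[𝕜] Y)
    (A : X →ₗ.[𝕜] X) : Set X :=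
  closure {x : X | x ∈ A.domain ∧ ∃ hx : x ∈ S.domain, 0 ≤ S ⟨x, hx⟩}

/-- The semigroup `T` with generator `A` preserves `S`-shape: `C = C_A`, and every `T(t)`
leaves `C` invariant. -/
def C0Semigroup.PreservesShape {𝕜 X Y : Type*} [RCLike 𝕜] [NormedAddCommGroup X]
    [NormedSpace 𝕜 X] [NormedAddCommGroup Y] [NormedSpace 𝕜 Y] [PartialOrder Y]
    (T : C0Semigroup 𝕜 X) (S : X →ₗ.[𝕜] Y) : Prop :=
  shapeCone S = shapeConeOn S T.generator ∧
    ∀ t : ℝ≥0, Set.MapsTo (T.op t) (shapeCone S) (shapeCone S)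

/-! Since $C$ is closed and invariant under $V(t/n)^n$, it suffices to prove the Chernoff formula
$V(t/n)^n x\to e^{tA}x$ (`tendsto_chernoff`). Let $B_h=h^{-1}(V(h)-1)$. For one fixed large $\mu$
and $0<h\le 1$, a Neumann series gives resolvents $R_h=(\mu-B_h)^{-1}$ with $\|R_h\|\le M$
(`exists_resolvent_difference_quotient`). Convergence of $B_h$ to $A$ on the core, together with
this bound, gives $R_h(\mu x-Ax)\to x$ on all of $D(A)$ (`tendsto_resolventDefect`), uniformly along
the compact orbit $s\mapsto(e^{sA}x,e^{sA}Ax)$, $s\le t$. Hence $V(h)R_h-R_he^{hA}$ is $o(h)$ along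
such orbits, and telescoping $n$ steps with $h=t/n$ gives $V(h)^nR_hx-R_he^{tA}x\to0$ for $x\in
D(A)$ (`tendsto_pow_resolvent_sub`). For $x\in D(A^2)$, applying this to $\mu x-Ax\in D(A)$ removes
the resolvents; density of $D(A^2)$ and power-boundedness finish. No resolvent of $A$ itself is
needed. -/

/-! ### Norm-bounded families of operators -/

section EquiboundedFamilies

variable {𝕜 E G ι : Type*} [RCLike 𝕜] [NormedAddCommGroup E] [NormedSpace 𝕜 E]
  [NormedAddCommGroup G] [NormedSpace 𝕜 G]

/-- A family of operators that is eventually bounded in norm and tends to zero pointwise on a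
compact set tends to zero uniformly on it. -/
theorem ContinuousLinearMap.eventually_forall_norm_lt_of_isCompact {l : Filter ι}
    {F : ι → E →L[𝕜] G} {K ε : ℝ} (hF : ∀ᶠ i in l, ‖F i‖ ≤ K) {Q : Set E} (hQ : IsCompact Q)
    (h0 : ∀ x ∈ Q, Tendsto (fun i => F i x) l (𝓝 0)) (hε : 0 < ε) :
    ∀ᶠ i in l, ∀ x ∈ Q, ‖F i x‖ < ε := by
  refine hQ.induction_on (p := fun s => ∀ᶠ i in l, ∀ x ∈ s, ‖F i x‖ < ε) (by simp)
    (fun s t hst ht => ht.mono fun i hi x hx => hi x (hst hx)) ?_ ?_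
  · intro s t hs ht
    filter_upwards [hs, ht] with i h1 h2 x hx
    exact hx.elim (h1 x) (h2 x)
  · intro x hx
    have hK : 0 < |K| + 1 := by positivity
    refine ⟨Metric.ball x (ε / 2 / (|K| + 1)),
      mem_nhdsWithin_of_mem_nhds (Metric.ball_mem_nhds x (by positivity)), ?_⟩
    have hx0 : ∀ᶠ i in l, ‖F i x‖ < ε / 2 :=
      ((h0 x hx).norm).eventually_lt_const (by simpa using half_pos hε)
    filter_upwards [hF, hx0] with i hi hix y hy
    have h1 : ‖F i (y - x)‖ ≤ (|K| + 1) * ‖y - x‖ :=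
      (F i).le_of_opNorm_le (by linarith [le_abs_self K]) _
    have h2 : (|K| + 1) * ‖y - x‖ < ε / 2 := by
      rw [Metric.mem_ball, dist_eq_norm, lt_div_iff₀ hK] at hy
      linarith
    calc ‖F i y‖ = ‖F i (y - x) + F i x‖ := by rw [map_sub, sub_add_cancel]
      _ ≤ ‖F i (y - x)‖ + ‖F i x‖ := norm_add_le _ _
      _ < ε := by linarith

/-- The set where an eventually norm-bounded family of operators tends to zero is closed. -/
theorem ContinuousLinearMap.tendsto_zero_of_mem_closure {l : Filter ι}
    {F : ι → E →L[𝕜] G} {K : ℝ} (hF : ∀ᶠ i in l, ‖F i‖ ≤ K) {s : Set E}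
    (h0 : ∀ x ∈ s, Tendsto (fun i => F i x) l (𝓝 0)) {x : E} (hx : x ∈ closure s) :
    Tendsto (fun i => F i x) l (𝓝 0) := by
  rw [Metric.tendsto_nhds]
  intro ε hε
  have hK : 0 < |K| + 1 := by positivity
  obtain ⟨y, hy, hxy⟩ := Metric.mem_closure_iff.1 hx (ε / 2 / (|K| + 1)) (by positivity)
  have hy0 : ∀ᶠ i in l, ‖F i y‖ < ε / 2 :=
    ((h0 y hy).norm).eventually_lt_const (by simpa using half_pos hε)
  filter_upwards [hF, hy0] with i hi hiy
  have h1 : ‖F i (x - y)‖ ≤ (|K| + 1) * ‖x - y‖ :=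
    (F i).le_of_opNorm_le (by linarith [le_abs_self K]) _
  have h2 : (|K| + 1) * ‖x - y‖ < ε / 2 := by
    rw [dist_eq_norm, lt_div_iff₀ hK] at hxy
    linarith
  rw [dist_zero_right]
  calc ‖F i x‖ = ‖F i (x - y) + F i y‖ := by rw [map_sub, sub_add_cancel]
    _ ≤ ‖F i (x - y)‖ + ‖F i y‖ := norm_add_le _ _
    _ < ε := by linarith

end EquiboundedFamilies

/-! ### Resolvents of difference quotients and telescoping of powers -/

section DifferenceQuotient

variable {𝕜 X : Type*} [RCLike 𝕜] [NormedAddCommGroup X] [NormedSpace 𝕜 X]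

/-- If the powers of `V` are bounded by `M * exp (n * h * ω)`, then the difference quotient
`h⁻¹ (V - 1)` has a resolvent at `|ω| * exp |ω| + 1`, of norm at most `M`. -/
theorem exists_resolvent_difference_quotient [CompleteSpace X] {V : X →L[𝕜] X} {h M ω : ℝ}
    (h0 : 0 < h) (h1 : h ≤ 1) (hM : 0 ≤ M) (hV : ∀ n : ℕ, ‖V ^ n‖ ≤ M * Real.exp (h * n * ω)) :
    ∃ R : X →L[𝕜] X, ‖R‖ ≤ M ∧
      (∀ x, R ((((|ω| * Real.exp |ω| + 1 : ℝ)) : 𝕜) • x - (h : 𝕜)⁻¹ • (V x - x)) = x) ∧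
      ∀ x, (((|ω| * Real.exp |ω| + 1 : ℝ)) : 𝕜) • R x - (h : 𝕜)⁻¹ • (V (R x) - R x) = x := by
  set μ : ℝ := |ω| * Real.exp |ω| + 1 with hμ
  set a : ℝ := 1 + μ * h with ha
  have hμ0 : 0 < μ := by positivity
  have ha0 : 0 < a := by positivity
  -- The choice of $\mu$ is made for this gap: $e^u\le 1+ue^u$ with $u=h|\omega|$ and $h\le1$. It
  -- yields both $q<1$ and $h/(a-e^{h\omega})\le1$, hence the bound $M$ independent of $h$.
  have hexp : Real.exp (h * ω) + h ≤ a := by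
    have e1 : Real.exp (h * ω) ≤ Real.exp (h * |ω|) :=
      Real.exp_le_exp.2 (mul_le_mul_of_nonneg_left (le_abs_self ω) h0.le)
    have e2 : Real.exp (h * |ω|) ≤ 1 + h * |ω| * Real.exp (h * |ω|) := by
      have e3 := mul_le_mul_of_nonneg_right (Real.add_one_le_exp (-(h * |ω|)))
        (Real.exp_pos (h * |ω|)).le
      rw [← Real.exp_add, neg_add_cancel, Real.exp_zero] at e3
      linarith
    have e4 : h * |ω| * Real.exp (h * |ω|) ≤ h * |ω| * Real.exp |ω| :=
      mul_le_mul_of_nonneg_left (Real.exp_le_exp.2 (mul_le_of_le_one_left (abs_nonneg ω) h1))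
        (by positivity)
    rw [ha, hμ]
    linarith
  set q : ℝ := Real.exp (h * ω) / a with hq
  have hq0 : 0 ≤ q := by positivity
  have hq1 : q < 1 := by
    rw [hq, div_lt_one ha0]
    linarith
  -- $\mu-h^{-1}(V-1)=h^{-1}a(1-U)$, so the resolvent is $ha^{-1}\sum U^n$. The series converges by
  -- the bounds on the powers of $V$; $\|U\|<1$ is not required.
  set U : X →L[𝕜] X := (a : 𝕜)⁻¹ • V with hU
  have hUn : ∀ n : ℕ, ‖U ^ n‖ ≤ M * q ^ n := by
    intro n
    rw [hU, smul_pow, norm_smul, norm_pow, norm_inv, RCLike.norm_ofReal, abs_of_pos ha0, hq,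
      div_pow, ← Real.exp_nat_mul, inv_pow, inv_mul_le_iff₀ (by positivity)]
    refine (hV n).trans_eq ?_
    rw [show h * n * ω = n * (h * ω) by ring]
    field_simp
  have hgeo : HasSum (fun n : ℕ => M * q ^ n) (M * (1 - q)⁻¹) :=
    (hasSum_geometric_of_lt_one hq0 hq1).mul_left M
  have hsum : Summable (U ^ · : ℕ → X →L[𝕜] X) := .of_norm_bounded hgeo.summable hUn
  have hnorm : ‖∑' n : ℕ, U ^ n‖ ≤ M * (1 - q)⁻¹ := tsum_of_norm_bounded hgeo hUn
  have hleft := hsum.tsum_pow_mul_one_sub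
  have hright := hsum.one_sub_mul_tsum_pow
  set P : X →L[𝕜] X := ∑' n : ℕ, U ^ n
  have hh : (h : 𝕜) ≠ 0 := by exact_mod_cast h0.ne'
  have haK : (a : 𝕜) ≠ 0 := by exact_mod_cast ha0.ne'
  have haμ : (a : 𝕜) = 1 + (μ : 𝕜) * (h : 𝕜) := by rw [ha]; push_cast; rfl
  have key : ∀ x, (μ : 𝕜) • x - (h : 𝕜)⁻¹ • (V x - x) =
      ((h : 𝕜)⁻¹ * (a : 𝕜)) • ((1 - U) x) := by
    intro x
    have e1 : ((1 : X →L[𝕜] X) - U) x = x - (a : 𝕜)⁻¹ • V x := rfl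
    rw [e1, smul_sub, smul_sub, smul_smul, mul_assoc, mul_inv_cancel₀ haK, mul_one, haμ, mul_add,
      mul_one, mul_comm (μ : 𝕜), inv_mul_cancel_left₀ hh, add_smul]
    abel
  refine ⟨((h : 𝕜) * (a : 𝕜)⁻¹) • P, ?_, fun x => ?_, fun x => ?_⟩
  · rw [norm_smul, norm_mul, norm_inv, RCLike.norm_ofReal, RCLike.norm_ofReal, abs_of_pos h0,
      abs_of_pos ha0]
    have hd : 0 < a - Real.exp (h * ω) := by linarith
    calc h * a⁻¹ * ‖P‖ ≤ h * a⁻¹ * (M * (1 - q)⁻¹) := by gcongr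
      _ = M * (h / (a - Real.exp (h * ω))) := by
        rw [hq, one_sub_div ha0.ne']
        field_simp
      _ ≤ M * 1 := by
        gcongr
        rw [div_le_one hd]
        linarith
      _ = M := mul_one M
  · rw [key, map_smul, smul_apply, ← mul_apply_eq_comp, hleft,
      smul_smul]
    have e : (h : 𝕜)⁻¹ * a * (h * (a : 𝕜)⁻¹) = 1 := by field_simp
    rw [e, one_smul, one_apply_eq_self]
  · rw [key, smul_apply, map_smul, ← mul_apply_eq_comp, hright,
      smul_smul]
    have e : (h : 𝕜)⁻¹ * a * (h * (a : 𝕜)⁻¹) = 1 := by field_simp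
    rw [e, one_smul, one_apply_eq_self]

/-- Telescoping bound for the defect of intertwining of two sequences of powers. -/
theorem norm_pow_apply_sub_le_of_step {V : X →L[𝕜] X} {w : ℕ → X} {n : ℕ} {K δ : ℝ}
    (hV : ∀ k < n, ‖V ^ k‖ ≤ K) (hw : ∀ k < n, ‖V (w k) - w (k + 1)‖ ≤ δ) :
    ‖(V ^ n) (w 0) - w n‖ ≤ n * (K * δ) := by
  have tele : ∑ k ∈ Finset.range n, ((V ^ (n - 1 - k)) (V (w k) - w (k + 1))) =
      (V ^ n) (w 0) - w n := by
    have e := Finset.sum_range_sub' (fun k => (V ^ (n - k)) (w k)) n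
    simp only [Nat.sub_zero, Nat.sub_self, pow_zero, one_apply_eq_self] at e
    rw [← e]
    refine Finset.sum_congr rfl fun k hk => ?_
    have hk := Finset.mem_range.1 hk
    rw [map_sub, ← mul_apply_eq_comp, ← pow_succ,
      show n - 1 - k + 1 = n - k by omega, show n - 1 - k = n - (k + 1) by omega]
  rw [← tele]
  refine (norm_sum_le_of_le _ fun k hk => ?_).trans_eq
    (by rw [Finset.sum_const, Finset.card_range, nsmul_eq_mul])
  have hk := Finset.mem_range.1 hk
  exact (ContinuousLinearMap.le_opNorm _ _).trans
    (mul_le_mul (hV _ (by omega)) (hw k hk) (norm_nonneg _)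
      ((norm_nonneg _).trans (hV _ (show n - 1 - k < n by omega))))

end DifferenceQuotient

/-! ### Orbit averages and density of the domain of the squared generator -/

namespace C0Semigroup

variable {𝕜 X : Type*} [RCLike 𝕜] [NormedAddCommGroup X] [NormedSpace 𝕜 X]

theorem op_add_apply (T : C0Semigroup 𝕜 X) (s t : ℝ≥0) (x : X) :
    T.op (s + t) x = T.op s (T.op t x) := by
  rw [T.op_add]; rfl

theorem op_zero_apply (T : C0Semigroup 𝕜 X) (x : X) : T.op 0 x = x := by
  rw [T.op_zero]; rfl

theorem op_comm_apply (T : C0Semigroup 𝕜 X) (s t : ℝ≥0) (x : X) :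
    T.op s (T.op t x) = T.op t (T.op s x) := by
  rw [← T.op_add_apply, add_comm, T.op_add_apply]

/-- The semigroup is bounded on compact time intervals. -/
theorem exists_norm_op_le [CompleteSpace X] (T : C0Semigroup 𝕜 X) (t : ℝ≥0) :
    ∃ K, ∀ s ≤ t, ‖T.op s‖ ≤ K := by
  obtain ⟨K, hK⟩ := banach_steinhaus (g := fun s : Set.Icc (0 : ℝ≥0) t => T.op s) fun x => by
    obtain ⟨C, hC⟩ := isCompact_Icc.exists_bound_of_continuousOn (s := Set.Icc (0 : ℝ≥0) t)
      (T.strongly_continuous x).continuousOn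
    exact ⟨C, fun s => hC s s.2⟩
  exact ⟨K, fun s hs => hK ⟨s, zero_le, hs⟩⟩

/-- The generator commutes with the semigroup. -/
theorem op_mem_generatorGraph (T : C0Semigroup 𝕜 X) (s : ℝ≥0) {x y : X}
    (h : (x, y) ∈ T.generatorGraph) : (T.op s x, T.op s y) ∈ T.generatorGraph := by
  change Tendsto _ _ _ at h
  refine (((T.op s).continuous.tendsto y).comp h).congr fun r => ?_
  simp only [Function.comp_apply, map_smul, map_sub]
  rw [T.op_comm_apply s r x]

theorem continuous_op_toNNReal (T : C0Semigroup 𝕜 X) (x : X) :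
    Continuous fun s : ℝ => T.op s.toNNReal x :=
  (T.strongly_continuous x).comp continuous_real_toNNReal

section Averages

variable [NormedSpace ℝ X] [CompleteSpace X]

theorem op_integral (T : C0Semigroup 𝕜 X) (x : X) (h ε : ℝ≥0) :
    T.op h (∫ s in (0 : ℝ)..ε, T.op s.toNNReal x) =
      (∫ s in (0 : ℝ)..(ε + h : ℝ), T.op s.toNNReal x) -
        ∫ s in (0 : ℝ)..h, T.op s.toNNReal x := by
  have hi := fun a b : ℝ => (T.continuous_op_toNNReal x).intervalIntegrable
    (μ := MeasureTheory.volume) a b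
  rw [← ContinuousLinearMap.intervalIntegral_comp_comm _ (hi 0 ε),
    intervalIntegral.integral_interval_sub_left (hi _ _) (hi _ _)]
  have e := intervalIntegral.integral_comp_add_right (a := 0) (b := ε)
    (fun s : ℝ => T.op s.toNNReal x) (h : ℝ)
  rw [zero_add] at e
  rw [← e]
  refine intervalIntegral.integral_congr fun s hs => ?_
  rw [Set.uIcc_of_le ε.coe_nonneg] at hs
  rw [← T.op_add_apply, add_comm, Real.toNNReal_add hs.1 h.coe_nonneg, Real.toNNReal_coe]

variable [IsScalarTower ℝ 𝕜 X]

/-- Right difference quotients of `s ↦ ∫₀ˢ T(r)x dr`. -/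
theorem tendsto_integral_quotient (T : C0Semigroup 𝕜 X) (x : X) (ε : ℝ≥0) :
    Tendsto (fun h : ℝ≥0 => ((h : ℝ) : 𝕜)⁻¹ • ((∫ s in (0 : ℝ)..(ε + h : ℝ), T.op s.toNNReal x) -
      ∫ s in (0 : ℝ)..ε, T.op s.toNNReal x)) (𝓝[>] 0) (𝓝 (T.op ε x)) := by
  have hc := T.continuous_op_toNNReal x
  have hd : HasDerivAt (fun u : ℝ => ∫ s in (0 : ℝ)..u, T.op s.toNNReal x)
      (T.op (ε : ℝ).toNNReal x) ε :=
    intervalIntegral.integral_hasDerivAt_right (hc.intervalIntegrable _ _)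
      hc.stronglyMeasurable.stronglyMeasurableAtFilter hc.continuousAt
  rw [Real.toNNReal_coe, hasDerivAt_iff_tendsto_slope_zero] at hd
  have hco : Tendsto (fun h : ℝ≥0 => (h : ℝ)) (𝓝[>] 0) (𝓝[≠] 0) :=
    tendsto_nhdsWithin_iff.2 ⟨(NNReal.continuous_coe.tendsto' 0 0 rfl).mono_left
      nhdsWithin_le_nhds, by
        filter_upwards [self_mem_nhdsWithin] with h hh
        exact_mod_cast (ne_of_gt hh)⟩
  refine (hd.comp hco).congr fun h => ?_
  rw [Function.comp_apply, ← RCLike.ofReal_inv, RCLike.real_smul_eq_coe_smul (K := 𝕜)]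

/-- Applying $T(h)$ shifts the interval of integration, so the increment is
$\int_\varepsilon^{\varepsilon+h}-\int_0^h$; divided by $h$, the two pieces tend to
$T(\varepsilon)x$ and $x$. -/
theorem integral_mem_generatorGraph (T : C0Semigroup 𝕜 X) (x : X) (ε : ℝ≥0) :
    (∫ s in (0 : ℝ)..ε, T.op s.toNNReal x, T.op ε x - x) ∈ T.generatorGraph := by
  have h := (T.tendsto_integral_quotient x ε).sub (T.tendsto_integral_quotient x 0)
  rw [T.op_zero_apply] at h
  refine h.congr fun r => ?_
  simp only [NNReal.coe_zero, zero_add, intervalIntegral.integral_same, sub_zero]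
  rw [T.op_integral, ← smul_sub]
  congr 1
  abel

/-- The averages $h^{-1}\int_0^hT(r)x\,dr$ lie in the submodule and tend to $x$. -/
theorem mem_closure_of_integral_mem (T : C0Semigroup 𝕜 X) (x : X) (s : Submodule 𝕜 X)
    (h : ∀ ε : ℝ≥0, (∫ s in (0 : ℝ)..ε, T.op s.toNNReal x) ∈ s) : x ∈ closure (s : Set X) := by
  have ht := T.tendsto_integral_quotient x 0
  rw [T.op_zero_apply] at ht
  refine mem_closure_of_tendsto ht (.of_forall fun r => ?_)
  simp only [NNReal.coe_zero, zero_add, intervalIntegral.integral_same, sub_zero]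
  exact s.smul_mem _ (h r)

end Averages

/-- The domain of the square of the generator. -/
def generatorSqDomain (T : C0Semigroup 𝕜 X) : Submodule 𝕜 X :=
  (T.generatorGraph ⊓ (T.generatorGraph.map (LinearMap.fst 𝕜 X X)).comap
    (LinearMap.snd 𝕜 X X)).map (LinearMap.fst 𝕜 X X)

theorem mem_generatorSqDomain (T : C0Semigroup 𝕜 X) {x : X} :
    x ∈ T.generatorSqDomain ↔
      ∃ y z, (x, y) ∈ T.generatorGraph ∧ (y, z) ∈ T.generatorGraph := by
  simp [generatorSqDomain]

/-- The domain of the square of the generator is dense. -/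
theorem dense_generatorSqDomain [CompleteSpace X] (T : C0Semigroup 𝕜 X) :
    Dense (T.generatorSqDomain : Set X) := by
  -- The integrals need a real structure on $X$, obtained here by restricting scalars.
  let _ : NormedSpace ℝ X := NormedSpace.restrictScalars ℝ 𝕜 X
  have _ : IsScalarTower ℝ 𝕜 X := RestrictScalars.isScalarTower ℝ 𝕜 X
  have h1 : ∀ x ∈ T.generatorGraph.map (LinearMap.fst 𝕜 X X),
      x ∈ closure (T.generatorSqDomain : Set X) := by
    rintro x ⟨⟨x, y⟩, hxy, rfl⟩
    change (x, y) ∈ T.generatorGraph at hxy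
    change x ∈ _
    -- For $x\in D(A)$, $A\int_0^\varepsilon T(s)x\,ds=T(\varepsilon)x-x$ is again in $D(A)$, so the
    -- averages lie in $D(A^2)$.
    exact T.mem_closure_of_integral_mem x _ fun ε => T.mem_generatorSqDomain.2
      ⟨T.op ε x - x, T.op ε y - y, T.integral_mem_generatorGraph x ε, by
        simpa only [Prod.mk_sub_mk] using
          T.generatorGraph.sub_mem (T.op_mem_generatorGraph ε hxy) hxy⟩
  intro x
  have h2 : x ∈ closure (T.generatorGraph.map (LinearMap.fst 𝕜 X X) : Set X) :=
    T.mem_closure_of_integral_mem x _ fun ε =>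
      Submodule.mem_map.2 ⟨_, T.integral_mem_generatorGraph x ε, rfl⟩
  exact closure_minimal h1 isClosed_closure h2

end C0Semigroup

/-! ### Approximate intertwining and the Chernoff formula -/

namespace C0Semigroup

variable {𝕜 X : Type*} [RCLike 𝕜] [NormedAddCommGroup X] [NormedSpace 𝕜 X]

/-- The defect `(x, y) ↦ R (μ x - y) - x`, which vanishes on the graph of an operator `A` when `R`
is a left inverse of `μ - A`. -/
def resolventDefect (μ : 𝕜) (R : X →L[𝕜] X) : X × X →L[𝕜] X :=
  R.comp (μ • ContinuousLinearMap.fst 𝕜 X X - ContinuousLinearMap.snd 𝕜 X X) -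
    ContinuousLinearMap.fst 𝕜 X X

theorem resolventDefect_apply (μ : 𝕜) (R : X →L[𝕜] X) (x y : X) :
    resolventDefect μ R (x, y) = R (μ • x - y) - x := rfl

theorem exists_norm_resolventDefect_le (μ : 𝕜) (M : ℝ) :
    ∃ K, ∀ R : X →L[𝕜] X, ‖R‖ ≤ M → ‖resolventDefect μ R‖ ≤ K :=
  ⟨M * ‖μ • ContinuousLinearMap.fst 𝕜 X X - ContinuousLinearMap.snd 𝕜 X X‖ +
    ‖ContinuousLinearMap.fst 𝕜 X X‖, fun _ hR => (norm_sub_le _ _).trans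
      (add_le_add_left ((ContinuousLinearMap.opNorm_comp_le _ _).trans
        (mul_le_mul_of_nonneg_right hR (norm_nonneg _))) _)⟩

/-- If `R h` are uniformly bounded left inverses of `μ - B h`, and the pair `p` is in the closure
of the set of limits of pairs `(x, B h x)`, then the resolvent defect of `R h` at `p` tends to
zero. -/
theorem tendsto_resolventDefect {ι : Type*} {l : Filter ι} {μ : 𝕜} {R : ι → X →L[𝕜] X} {M : ℝ}
    {B : ι → X → X} (hR : ∀ᶠ i in l, ‖R i‖ ≤ M)
    (hB : ∀ᶠ i in l, ∀ x, R i (μ • x - B i x) = x) {p : X × X}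
    (hp : p ∈ closure {p : X × X | Tendsto (fun i => B i p.1) l (𝓝 p.2)}) :
    Tendsto (fun i => resolventDefect μ (R i) p) l (𝓝 0) := by
  obtain ⟨K, hK⟩ := exists_norm_resolventDefect_le (X := X) μ M
  refine ContinuousLinearMap.tendsto_zero_of_mem_closure (F := fun i => resolventDefect μ (R i))
    (hR.mono fun i hi => hK (R i) hi) ?_ hp
  rintro ⟨x, y⟩ (hxy : Tendsto (fun i => B i x) l (𝓝 y))
  have h0 : Tendsto (fun i => M * ‖B i x - y‖) l (𝓝 0) := by
    simpa using (tendsto_iff_norm_sub_tendsto_zero.1 hxy).const_mul M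
  refine squeeze_zero_norm' ?_ h0
  filter_upwards [hR, hB] with i hRi hBi
  -- Substituting $x=R_i(\mu x-B_ix)$ for the subtracted $x$ leaves only the error $B_ix-y$.
  have e : resolventDefect μ (R i) (x, y) = R i (B i x - y) := by
    rw [resolventDefect_apply]
    nth_rewrite 2 [← hBi x]
    rw [← map_sub]
    congr 1
    abel
  rw [e]
  exact (R i).le_of_opNorm_le hRi _

/-- The one-step defect of intertwining `V` and `T(h)` by a right inverse `R` of
`μ - h⁻¹ (V - 1)`. -/
theorem intertwining_step (T : C0Semigroup 𝕜 X) {V R : X →L[𝕜] X} {h : ℝ≥0} {μ : 𝕜} (h0 : h ≠ 0)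
    (hR : ∀ x, μ • R x - ((h : ℝ) : 𝕜)⁻¹ • (V (R x) - R x) = x) (s : ℝ≥0) (x y : X) :
    V (R (T.op s x)) - R (T.op (s + h) x) =
      ((h : ℝ) : 𝕜) • (resolventDefect μ R (T.op s x, T.op s y) -
        R (T.op s (((h : ℝ) : 𝕜)⁻¹ • (T.op h x - x) - y))) := by
  have hK : ((h : ℝ) : 𝕜) ≠ 0 := by exact_mod_cast h0
  have h1 : V (R (T.op s x)) - R (T.op s x) =
      ((h : ℝ) : 𝕜) • (μ • R (T.op s x) - T.op s x) := by
    have e := hR (T.op s x)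
    rw [sub_eq_iff_eq_add'] at e
    rw [e, add_sub_cancel_right, smul_inv_smul₀ hK]
  rw [resolventDefect_apply, T.op_add_apply]
  simp only [map_sub, map_smul, smul_sub, smul_inv_smul₀ hK] at h1 ⊢
  rw [sub_eq_iff_eq_add] at h1
  rw [h1]
  abel

/-- Approximate intertwining of the powers of `V(t/n)` with the semigroup by resolvents of the
difference quotients. -/
theorem tendsto_pow_resolvent_sub [CompleteSpace X] (T : C0Semigroup 𝕜 X) {V R : ℝ≥0 → X →L[𝕜] X} {M ω : ℝ} {μ : 𝕜}
    (hbound : ∀ (t : ℝ≥0) (n : ℕ), ‖V t ^ n‖ ≤ M * Real.exp (t * n * ω)) (hM : 0 ≤ M)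
    (hRM : ∀ᶠ h in 𝓝[>] 0, ‖R h‖ ≤ M)
    (hR : ∀ᶠ h in 𝓝[>] 0, ∀ x,
      μ • R h x - ((h : ℝ) : 𝕜)⁻¹ • (V h (R h x) - R h x) = x)
    (hdef : ∀ p ∈ T.generatorGraph,
      Tendsto (fun h => resolventDefect μ (R h) p) (𝓝[>] 0) (𝓝 0))
    {t : ℝ≥0} {x y : X} (hxy : (x, y) ∈ T.generatorGraph) {h : ℕ → ℝ≥0}
    (hh : Tendsto h atTop (𝓝[>] 0)) (hht : ∀ᶠ n : ℕ in atTop, n * h n = t) :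
    Tendsto (fun n => (V (h n) ^ n) (R (h n) x) - R (h n) (T.op t x)) atTop (𝓝 0) := by
  obtain ⟨K, hK⟩ := T.exists_norm_op_le t
  have hK0 : 0 ≤ K := (norm_nonneg _).trans (hK 0 zero_le)
  set K' : ℝ := M * Real.exp (t * |ω|) with hK'
  have hK'0 : 0 ≤ K' := by positivity
  obtain ⟨L, hL⟩ := exists_norm_resolventDefect_le (X := X) μ M
  have hQ : IsCompact ((fun s => (T.op s x, T.op s y)) '' Set.Icc 0 t) :=
    isCompact_Icc.image ((T.strongly_continuous x).prodMk (T.strongly_continuous y))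
  have hstep : ∀ ε > 0, ∀ᶠ n : ℕ in atTop,
      ‖(V (h n) ^ n) (R (h n) x) - R (h n) (T.op t x)‖ ≤ t * K' * (1 + M * K) * ε := by
    intro ε hε
    have hunif := ContinuousLinearMap.eventually_forall_norm_lt_of_isCompact
      (F := fun h => resolventDefect μ (R h)) (hRM.mono fun i hi => hL (R i) hi) hQ (fun p hp => by
        obtain ⟨s, -, rfl⟩ := hp
        exact hdef _ (T.op_mem_generatorGraph s hxy)) hε
    have hgen : ∀ᶠ r : ℝ≥0 in 𝓝[>] 0, ‖((r : ℝ) : 𝕜)⁻¹ • (T.op r x - x) - y‖ < ε :=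
      (tendsto_iff_norm_sub_tendsto_zero.1 hxy).eventually_lt_const hε
    filter_upwards [hht, hh.eventually hRM, hh.eventually hR, hh.eventually hunif,
      hh.eventually hgen, hh.eventually self_mem_nhdsWithin] with n hn hRn hRn' hu hg hpos
    have hpos : 0 < h n := hpos
    have hle : ∀ k < n, k * h n ≤ t := fun k hk => by
      rw [← hn]
      gcongr
    -- Each step costs $h_n$ times a small quantity: $\varepsilon$ from the defect on the orbit and
    -- $MK\varepsilon$ from the difference quotient of $T$. The $n$ steps add up to the factor
    -- $nh_n=t$.
    have hb := norm_pow_apply_sub_le_of_step (V := V (h n)) (w := fun k => R (h n) (T.op (k * h n) x))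
      (n := n) (K := K') (δ := h n * ((1 + M * K) * ε)) ?_ ?_
    · simp only [Nat.cast_zero, zero_mul, T.op_zero_apply, hn] at hb
      refine hb.trans_eq ?_
      rw [← hn]
      push_cast
      ring
    · intro k hk
      refine (hbound _ k).trans ?_
      rw [hK']
      refine mul_le_mul_of_nonneg_left (Real.exp_le_exp.2 ?_) hM
      have hk' : (h n : ℝ) * k ≤ t := by
        rw [mul_comm]
        exact_mod_cast hle k hk
      exact (mul_le_mul_of_nonneg_left (le_abs_self ω) (by positivity)).trans
        (mul_le_mul_of_nonneg_right hk' (abs_nonneg ω))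
    · intro k hk
      rw [Nat.cast_succ, add_mul, one_mul, T.intertwining_step hpos.ne' hRn' (k * h n) x y,
        norm_smul, RCLike.norm_ofReal, abs_of_nonneg (h n).coe_nonneg]
      refine mul_le_mul_of_nonneg_left ((norm_sub_le _ _).trans ?_) (h n).coe_nonneg
      have h1 := (hu _ ⟨k * h n, ⟨zero_le, hle k hk⟩, rfl⟩).le
      have h2 : ‖R (h n) (T.op (k * h n) (((h n : ℝ) : 𝕜)⁻¹ • (T.op (h n) x - x) - y))‖ ≤
          M * (K * ε) :=
        (R (h n)).le_of_opNorm_le_of_le hRn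
          ((T.op (k * h n)).le_of_opNorm_le_of_le (hK _ (hle k hk)) hg.le)
      linarith
  rw [Metric.tendsto_nhds]
  intro ε hε
  have hc : 0 < t * K' * (1 + M * K) + 1 := by positivity
  filter_upwards [hstep (ε / (t * K' * (1 + M * K) + 1)) (by positivity)] with n hn
  rw [dist_zero_right]
  refine hn.trans_lt ?_
  rw [← mul_div_assoc, div_lt_iff₀ hc]
  linarith

/-- **Chernoff product formula.** If the powers of `V(t)` are bounded by `M exp (t n ω)` and the
closure of the graph of the right derivative of `V` at `0` contains the graph of the generator of
`T`, then
`V(t/n)ⁿ x → T(t) x` for `t ≠ 0`. -/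
theorem tendsto_chernoff [CompleteSpace X] (T : C0Semigroup 𝕜 X) {V : ℝ≥0 → X →L[𝕜] X} {M ω : ℝ}
    (hM : 0 ≤ M) (hbound : ∀ (t : ℝ≥0) (n : ℕ), ‖V t ^ n‖ ≤ M * Real.exp (t * n * ω))
    (hV : (T.generatorGraph : Set (X × X)) ⊆ closure {p : X × X |
      Tendsto (fun h : ℝ≥0 => ((h : ℝ) : 𝕜)⁻¹ • (V h p.1 - p.1)) (𝓝[>] 0) (𝓝 p.2)})
    {t : ℝ≥0} (ht : t ≠ 0) (x : X) :
    Tendsto (fun n : ℕ => (V (t / n) ^ n) x) atTop (𝓝 (T.op t x)) := by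
  have ex : ∀ h : ℝ≥0, ∃ R : X →L[𝕜] X, 0 < h → h ≤ 1 → ‖R‖ ≤ M ∧
      (∀ x, R ((((|ω| * Real.exp |ω| + 1 : ℝ)) : 𝕜) • x - ((h : ℝ) : 𝕜)⁻¹ • (V h x - x)) = x) ∧
      ∀ x, (((|ω| * Real.exp |ω| + 1 : ℝ)) : 𝕜) • R x -
        ((h : ℝ) : 𝕜)⁻¹ • (V h (R x) - R x) = x := by
    intro h
    by_cases hh : 0 < h ∧ h ≤ 1
    · obtain ⟨R, hR⟩ := exists_resolvent_difference_quotient (V := V h) (h := h)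
        (by exact_mod_cast hh.1) (by exact_mod_cast hh.2) hM (hbound h)
      exact ⟨R, fun _ _ => hR⟩
    -- The value outside $(0,1]$ is arbitrary, since only $h\to0+$ is used.
    · exact ⟨0, fun h1 h2 => (hh ⟨h1, h2⟩).elim⟩
  choose R hR using ex
  set μ : 𝕜 := ((|ω| * Real.exp |ω| + 1 : ℝ) : 𝕜)
  have hev : ∀ᶠ h : ℝ≥0 in 𝓝[>] 0, 0 < h ∧ h ≤ 1 :=
    (eventually_mem_nhdsWithin (s := Set.Ioi (0 : ℝ≥0))).and
      (nhdsWithin_le_nhds (Iic_mem_nhds one_pos))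
  have hRM : ∀ᶠ h in 𝓝[>] 0, ‖R h‖ ≤ M := hev.mono fun h hh => (hR h hh.1 hh.2).1
  have hdef : ∀ p ∈ T.generatorGraph,
      Tendsto (fun h => resolventDefect μ (R h) p) (𝓝[>] 0) (𝓝 0) := fun p hp =>
    tendsto_resolventDefect hRM (hev.mono fun h hh => (hR h hh.1 hh.2).2.1) (hV hp)
  have hh : Tendsto (fun n : ℕ => t / n) atTop (𝓝[>] 0) := by
    refine tendsto_nhdsWithin_iff.2
      ⟨NNReal.tendsto_coe.1 ?_, ?_⟩
    · simpa using tendsto_const_div_atTop_nhds_zero_nat (t : ℝ)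
    filter_upwards [eventually_gt_atTop 0] with n hn
    have : (0 : ℝ≥0) < n := by exact_mod_cast hn
    exact div_pos (pos_iff_ne_zero.2 ht) this
  have hht : ∀ᶠ n : ℕ in atTop, n * (t / n) = t := by
    filter_upwards [eventually_ne_atTop 0] with n hn
    exact mul_div_cancel₀ t (by exact_mod_cast hn)
  have hpow : ∀ᶠ n : ℕ in atTop, ‖V (t / n) ^ n‖ ≤ M * Real.exp (t * ω) := by
    filter_upwards [hht] with n hn
    refine (hbound _ n).trans_eq ?_
    rw [mul_comm ((t / n : ℝ≥0) : ℝ)]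
    nth_rewrite 2 [← hn]
    push_cast
    rfl
  have hdense := ContinuousLinearMap.tendsto_zero_of_mem_closure (l := atTop)
    (F := fun n : ℕ => V (t / n) ^ n - T.op t) (K := M * Real.exp (t * ω) + ‖T.op t‖)
    (hpow.mono fun n hn => (norm_sub_le _ _).trans (add_le_add_left hn _))
    (s := T.generatorSqDomain) ?_ (T.dense_generatorSqDomain x)
  · simpa using hdense.add_const (T.op t x)
  intro x hx
  obtain ⟨y, z, hxy, hyz⟩ := T.mem_generatorSqDomain.1 hx
  -- Here $x\in D(A^2)$ is used: $\mu x-Ax$ must lie in $D(A)$ for the intertwining estimate. `l2`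
  -- and `l3` then replace $R_h(\mu x-Ax)$ by $x$, at time $t$ and under $V(t/n)^n$ respectively.
  have hmem : (μ • x - y, μ • y - z) ∈ T.generatorGraph := by
    simpa only [Prod.smul_mk, Prod.mk_sub_mk] using
      T.generatorGraph.sub_mem (T.generatorGraph.smul_mem μ hxy) hyz
  have l1 := T.tendsto_pow_resolvent_sub hbound hM hRM
    (hev.mono fun h hh => (hR h hh.1 hh.2).2.2) hdef hmem hh hht
  have l2 := (hdef _ (T.op_mem_generatorGraph t hxy)).comp hh
  have l3 : Tendsto (fun n : ℕ => (V (t / n) ^ n) (resolventDefect μ (R (t / n)) (x, y)))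
      atTop (𝓝 0) := by
    have l4 := ((hdef _ hxy).comp hh).norm.const_mul (M * Real.exp (t * ω))
    rw [norm_zero, mul_zero] at l4
    refine squeeze_zero_norm' ?_ l4
    filter_upwards [hpow] with n hn
    exact ContinuousLinearMap.le_of_opNorm_le _ hn _
  have l5 := (l1.sub l3).add l2
  rw [sub_zero, add_zero] at l5
  refine l5.congr fun n => ?_
  simp only [Function.comp_apply, resolventDefect_apply, map_sub, map_smul, sub_apply]
  abel

/-- A core of the generator is dense in its graph. -/
theorem generatorGraph_subset_closure_of_hasCore (T : C0Semigroup 𝕜 X) {D : Submodule 𝕜 X}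
    (hD : T.generator.HasCore D) :
    (T.generatorGraph : Set (X × X)) ⊆ closure {p | p.1 ∈ D ∧ p ∈ T.generator.graph} := by
  have hsub : ((T.generator.domRestrict D).graph : Set (X × X)) ⊆
      {p | p.1 ∈ D ∧ p ∈ T.generator.graph} := by
    rintro p hp
    refine ⟨?_, LinearPMap.le_graph_of_le LinearPMap.domRestrict_le hp⟩
    exact ((T.generator.domRestrict D).mem_domain_of_mem_graph hp).1
  rintro ⟨x, y⟩ hxy
  have hg : (x, y) ∈ T.generator.graph := (T.mem_graph_generator x y).2 hxy
  rw [← hD.closure_eq] at hg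
  -- The closure of a non-closable operator is by convention the operator itself, so the inclusion
  -- holds in that case too.
  by_cases hc : (T.generator.domRestrict D).IsClosable
  · rw [← hc.graph_closure_eq_closure_graph] at hg
    exact closure_mono hsub hg
  · rw [LinearPMap.closure_def' hc] at hg
    exact subset_closure (hsub hg)

end C0Semigroup

/-! ### Invariance of the shape cone -/

theorem mainTheorem4 {𝕜 X Y : Type*} [RCLike 𝕜]
    [NormedAddCommGroup X] [NormedSpace 𝕜 X] [CompleteSpace X]
    [NormedAddCommGroup Y] [NormedSpace 𝕜 Y] [CompleteSpace Y]
    [NormedSpace ℝ Y] [IsScalarTower ℝ 𝕜 Y]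
    [PartialOrder Y] [IsOrderedAddMonoid Y] [IsOrderedModule ℝ Y]
    (hY : IsClosed {y : Y | 0 ≤ y})
    (S : X →ₗ.[𝕜] Y) (hS : S.IsClosed)
    (T : C0Semigroup 𝕜 X) (A : X →ₗ.[𝕜] X) (hA : A = T.generator)
    (V : ℝ≥0 → X →L[𝕜] X) (hV : ∀ x : X, Continuous fun t : ℝ≥0 => V t x)
    (M ω : ℝ) (hM : 1 ≤ M)
    (hbound : ∀ (t : ℝ≥0) (n : ℕ), ‖V t ^ n‖ ≤ M * Real.exp (t * n * ω))
    (D : Submodule 𝕜 X) (hD : A.HasCore D)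
    (hlim : ∀ x : A.domain, (x : X) ∈ D →
      Tendsto (fun h : ℝ≥0 => ((h : ℝ) : 𝕜)⁻¹ • (V h x - x)) (𝓝[>] 0) (𝓝 (A x)))
    (hC : shapeCone S = shapeConeOn S A)
    (hVC : ∀ t : ℝ≥0, Set.MapsTo (V t) (shapeCone S) (shapeCone S)) :
    T.PreservesShape S := by
  subst hA
  refine ⟨hC, fun t x hx => ?_⟩
  -- At $t=0$ the steps $t/n$ vanish and do not approach $0$ through positive values; $T(0)$ is the
  -- identity.
  rcases eq_or_ne t 0 with rfl | ht
  · rwa [T.op_zero_apply]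
  have hlimit := T.tendsto_chernoff (zero_le_one.trans hM) hbound
    ((T.generatorGraph_subset_closure_of_hasCore hD).trans (closure_mono ?_)) ht x
  · refine isClosed_closure.mem_of_tendsto hlimit (.of_forall fun n => ?_)
    rw [FunLike.coe_pow_eq_iterate]
    exact (hVC _).iterate n hx
  · rintro ⟨x, y⟩ ⟨hxD, hxy⟩
    obtain ⟨x', rfl, rfl⟩ := (LinearPMap.mem_graph_iff _).1 hxy
    exact hlim x' hxD
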